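/- Let $R$ be a commutative ring with unit, let $\overline{\mathbb{N}}_0=\mathbb{N}_0\cup\{\infty\}$ be regarded as a poset category, and let $\vec X\colon\overline{\mathbb{N}}_0\to\mathbf{Top}$ be a functor, i.e. spaces $X_i$ and compatible continuous maps $X_i^j\colon X_i\to X_j$ for $i\le j$. Let $\mathcal F$ be a sheaf of $R$-modules on $X_\infty$. For $i\in\mathbb{N}_0$ put $\mathcal F^i=(X_i^\infty)^*\mathcal F$, so that $(X_i^{i+1})^*\mathcal F^{i+1}=\mathcal F^i$ by the canonical identification, and $\mathcal G_i=(X_i^\infty)_*\mathcal F^i$. Let $H^k(X,-)$ denote sheaf cohomology, the $k$-th right derived functor of the global section functor $\Gamma(X,-)$ on sheaves of $R$-modules. For a continuous map $f\colon X\to Y$ and a sheaf $\mathcal E$ on $Y$, let $H^k(f)\colon H^k(Y,\mathcal E)\to H^k(X,f^*\mathcal E)$ be the induced morphism: for injective resolutions $\mathcal E\to\mathcal I^\bullet$ and $f^*\mathcal E\to\mathcal J^\bullet$ and a cochain morphism $g^\bullet\colon f^*\mathcal I^\bullet\to\mathcal J^\bullet$ lifting the identity of $f^*\mathcal E$, it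 is induced on cohomology by the composition $\Gamma(Y,\mathcal I^\bullet)\to\Gamma(Y,f_*f^*\mathcal I^\bullet)=\Gamma(X,f^*\mathcal I^\bullet)\to\Gamma(X,\mathcal J^\bullet)$ of the unit of the adjunction $f^*\dashv f_*$ with $\Gamma(X,g^\bullet)$. Let $D^k(\vec X,\mathcal F)\colon\mathbb{N}_0^{\mathrm{op}}\to\mathbf{Mod}_R$ be the functor with $i\mapsto H^k(X_i,\mathcal F^i)$ whose maps from degree $i+1$ to degree $i$ are $$H^k(X_i^{i+1})\colon H^k(X_{i+1},\mathcal F^{i+1})\to H^k\big(X_i,(X_i^{i+1})^*\mathcal F^{i+1}\big)=H^k(X_i,\mathcal F^i).$$ Let $\mathcal G(\vec X,\mathcal F)$ be the functor from $\mathbb{N}_0^{\mathrm{op}}$ to sheaves of $R$-modules on $X_\infty$ with $i\mapsto\mathcal G_i$ whose maps $\mathcal G_{i+1}\to\mathcal G_i$ are $$(X_{i+1}^\infty)_*\eta_{i+1}\colon (X_{i+1}^\infty)_*\mathcal F^{i+1}\to (X_{i+1}^\infty)_*(X_i^{i+1})_*(X_i^{i+1})^*\mathcal F^{i+1}=(X_i^\infty)_*\mathcal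 F^i,$$ where $\eta_{i+1}\colon\mathcal F^{i+1}\to(X_i^{i+1})_*(X_i^{i+1})^*\mathcal F^{i+1}$ is the unit of the adjunction $(X_i^{i+1})^*\dashv(X_i^{i+1})_*$. Theorem. If the direct image functor $(X_i^j)_*$ on sheaves of $R$-modules is exact for all $i\le j$ in $\overline{\mathbb{N}}_0$, then for every $k\in\mathbb{N}_0$ there is an isomorphism of functors $\mathbb{N}_0^{\mathrm{op}}\to\mathbf{Mod}_R$ $$H^k(X_\infty,-)\circ\mathcal G(\vec X,\mathcal F)\;\cong\; D^k(\vec X,\mathcal F).$$ -/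

import Mathlib

open CategoryTheory Limits Opposite TopologicalSpace

universe u

noncomputable section

namespace SheafPersistence

section Lifting

variable {C : Type*} [Category C] [Abelian C]

/-- The comparison theorem for right resolutions: if `0 ⟶ Z ⟶ L⁰ ⟶ L¹ ⟶ ⋯` is exact and `J` is an
injective resolution of `Z`, then the identity of `Z` lifts to a cochain morphism `L ⟶ J`. -/
theorem exists_lift {Z : C} (L : CochainComplex C ℕ) (e : Z ⟶ L.X 0) [Mono e]
    (he : e ≫ L.d 0 1 = 0) (h₀ : (ShortComplex.mk e (L.d 0 1) he).Exact)
    (h : ∀ n, (ShortComplex.mk (L.d n (n + 1)) (L.d (n + 1) (n + 2)) (L.d_comp_d _ _ _)).Exact)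
    (J : InjectiveResolution Z) :
    ∃ g : L ⟶ J.cocomplex, e ≫ g.f 0 = (J.ι.f 0 : Z ⟶ J.cocomplex.X 0) := by
  let j : Z ⟶ J.cocomplex.X 0 := J.ι.f 0
  let g₀ : L.X 0 ⟶ J.cocomplex.X 0 := Injective.factorThru j e
  have hg₀ : e ≫ g₀ = j := Injective.comp_factorThru _ _
  have w₀ : e ≫ g₀ ≫ J.cocomplex.d 0 1 = 0 := by
    rw [← Category.assoc, hg₀]
    exact J.ι_f_zero_comp_complex_d
  let g₁ : L.X 1 ⟶ J.cocomplex.X 1 := h₀.descToInjective (g₀ ≫ J.cocomplex.d 0 1) w₀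
  have hg₁ : L.d 0 1 ≫ g₁ = g₀ ≫ J.cocomplex.d 0 1 := h₀.comp_descToInjective _ _
  refine ⟨CochainComplex.mkHom _ _ g₀ g₁ hg₁.symm (fun n p => ?_), ?_⟩
  · have w : L.d n (n + 1) ≫ p.2.1 ≫ J.cocomplex.d (n + 1) (n + 2) = 0 := by
      rw [← Category.assoc, ← p.2.2, Category.assoc, HomologicalComplex.d_comp_d, comp_zero]
    exact ⟨(h n).descToInjective (p.2.1 ≫ J.cocomplex.d (n + 1) (n + 2)) w,
      ((h n).comp_descToInjective _ _).symm⟩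
  · simpa using hg₀

end Lifting

variable (R : Type u) [CommRing R]

/-- The category of sheaves of `R`-modules on a topological space. -/
abbrev Shv (X : TopCat.{u}) : Type (u + 1) := TopCat.Sheaf (ModuleCat.{u} R) X

variable {X Y Z : TopCat.{u}}

/-- The direct image functor `f_*`. -/
abbrev push (f : X ⟶ Y) : Shv R X ⥤ Shv R Y := TopCat.Sheaf.pushforward (ModuleCat.{u} R) f

/-- The inverse image functor `f^*`. -/
abbrev pull (f : X ⟶ Y) : Shv R Y ⥤ Shv R X := TopCat.Sheaf.pullback (ModuleCat.{u} R) f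

/-- The adjunction `f^* ⊣ f_*`. -/
abbrev adj (f : X ⟶ Y) : pull R f ⊣ push R f :=
  TopCat.Sheaf.pullbackPushforwardAdjunction (ModuleCat.{u} R) f

instance (f : X ⟶ Y) : (push R f).Additive where

instance (f : X ⟶ Y) : (pull R f).Additive := (adj R f).left_adjoint_additive

attribute [local instance] reflectsLimits_of_reflectsIsomorphisms in
instance (f : X ⟶ Y) : PreservesFiniteLimits (pull R f) := by
  have : PreservesFiniteLimits ((Opens.map f).op.lan : (_ ⥤ _ ⥤ ModuleCat.{u} R)) := by
    apply lan_preservesFiniteLimits_of_flat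
  exact Functor.sheafPullbackConstruction.preservesFiniteLimits (Opens.map f) (ModuleCat.{u} R)
    (Opens.grothendieckTopology Y) (Opens.grothendieckTopology X)

instance (f : X ⟶ Y) : PreservesFiniteColimits (pull R f) := inferInstance

variable (X) in
/-- The global section functor `Γ(X, -)`. -/
def globalSections : Shv R X ⥤ ModuleCat.{u} R :=
  TopCat.Sheaf.forget (ModuleCat.{u} R) X ⋙ (evaluation _ _).obj (op ⊤)

instance : (globalSections R X).Additive where

variable (X) in
/-- Sheaf cohomology `H^k(X, -)`: the `k`-th right derived functor of `Γ(X, -)`. -/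
def H (k : ℕ) : Shv R X ⥤ ModuleCat.{u} R := (globalSections R X).rightDerived k

/-- `Γ(Y, f_* 𝓕) = Γ(X, 𝓕)`. -/
theorem push_comp_globalSections (f : X ⟶ Y) :
    push R f ⋙ globalSections R Y = globalSections R X := rfl

/-- The natural map `Γ(Y, 𝓕) ⟶ Γ(Y, f_* f^* 𝓕) = Γ(X, f^* 𝓕)` given by the adjunction unit. -/
def sectionsUnit (f : X ⟶ Y) : globalSections R Y ⟶ pull R f ⋙ globalSections R X :=
  Functor.whiskerRight (adj R f).unit (globalSections R Y)

variable {R}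

/-- `f^*` of an injective resolution `𝓕 ⟶ I`, followed by an injective resolution of `f^* 𝓕`:
the identity of `f^* 𝓕` lifts to a cochain morphism. -/
theorem exists_pull_lift (f : X ⟶ Y) {F : Shv R Y} (I : InjectiveResolution F)
    (J : InjectiveResolution ((pull R f).obj F)) :
    ∃ g : ((pull R f).mapHomologicalComplex _).obj I.cocomplex ⟶ J.cocomplex,
      (pull R f).map (I.ι.f 0 : F ⟶ I.cocomplex.X 0) ≫ g.f 0 =
        (J.ι.f 0 : (pull R f).obj F ⟶ J.cocomplex.X 0) := by
  let i : F ⟶ I.cocomplex.X 0 := I.ι.f 0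
  have : Mono i := inferInstanceAs (Mono (I.ι.f 0))
  have hi : Mono ((pull R f).map i) := inferInstance
  exact @exists_lift _ _ _ _ (((pull R f).mapHomologicalComplex _).obj I.cocomplex)
    ((pull R f).map i) hi _ (I.exact₀.map (pull R f))
    (fun n => (I.exact_succ n).map (pull R f)) J

/-- A chosen cochain morphism `f^* I ⟶ J` lifting the identity of `f^* 𝓕`. -/
def pullLift (f : X ⟶ Y) {F : Shv R Y} (I : InjectiveResolution F)
    (J : InjectiveResolution ((pull R f).obj F)) :
    ((pull R f).mapHomologicalComplex _).obj I.cocomplex ⟶ J.cocomplex :=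
  (exists_pull_lift f I J).choose

/-- The cochain morphism `Γ(Y, I) ⟶ Γ(X, f^* I) ⟶ Γ(X, J)`. -/
def inducedCochainMap (f : X ⟶ Y) {F : Shv R Y} (I : InjectiveResolution F)
    (J : InjectiveResolution ((pull R f).obj F)) :
    ((globalSections R Y).mapHomologicalComplex _).obj I.cocomplex ⟶
      ((globalSections R X).mapHomologicalComplex _).obj J.cocomplex :=
  (NatTrans.mapHomologicalComplex (sectionsUnit R f) _).app I.cocomplex ≫
    ((globalSections R X).mapHomologicalComplex _).map (pullLift f I J)

/-- The morphism `H^k(f) : H^k(Y, 𝓕) ⟶ H^k(X, f^* 𝓕)` induced by a continuous map. -/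
def inducedMap (f : X ⟶ Y) (F : Shv R Y) (k : ℕ) :
    (H R Y k).obj F ⟶ (H R X k).obj ((pull R f).obj F) :=
  ((injectiveResolution F).isoRightDerivedObj (globalSections R Y) k).hom ≫
    HomologicalComplex.homologyMap
      (inducedCochainMap f (injectiveResolution F) (injectiveResolution ((pull R f).obj F))) k ≫
    ((injectiveResolution ((pull R f).obj F)).isoRightDerivedObj (globalSections R X) k).inv

variable (R)

/-- `g_* f_* = h_*` when `h = g ∘ f`. -/
theorem push_comp {f : X ⟶ Y} {g : Y ⟶ Z} {h : X ⟶ Z} (w : f ≫ g = h) :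
    push R f ⋙ push R g = push R h := by
  subst w; rfl

/-- The canonical identification `f^* g^* = h^*` when `h = g ∘ f`, coming from uniqueness of left
adjoints and `g_* f_* = h_*`. -/
def pullComp {f : X ⟶ Y} {g : Y ⟶ Z} {h : X ⟶ Z} (w : f ≫ g = h) :
    pull R g ⋙ pull R f ≅ pull R h :=
  (((adj R g).comp (adj R f)).ofNatIsoRight (eqToIso (push_comp R w))).leftAdjointUniq (adj R h)

variable {R}

/-- The map `X_i ⟶ X_j` of a diagram of spaces over `ℕ ∪ {∞}`. -/
abbrev transition (X : ℕ∞ ⥤ TopCat.{u}) {i j : ℕ∞} (h : i ≤ j) : X.obj i ⟶ X.obj j :=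
  X.map (homOfLE h)

/-- The map `X_n ⟶ X_{n+1}`. -/
abbrev step (X : ℕ∞ ⥤ TopCat.{u}) (n : ℕ) : X.obj (n : ℕ∞) ⟶ X.obj ((n + 1 : ℕ) : ℕ∞) :=
  transition X (by exact_mod_cast n.le_succ)

/-- The map `X_n ⟶ X_∞`. -/
abbrev toTop (X : ℕ∞ ⥤ TopCat.{u}) (n : ℕ) : X.obj (n : ℕ∞) ⟶ X.obj ⊤ :=
  transition X le_top

theorem step_toTop (X : ℕ∞ ⥤ TopCat.{u}) (n : ℕ) : step X n ≫ toTop X (n + 1) = toTop X n := by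
  rw [← X.map_comp]; rfl

/-- The sheaf `𝓕ⁿ = (X_n^∞)^* 𝓕` on `X_n`. -/
abbrev pulled (X : ℕ∞ ⥤ TopCat.{u}) (F : Shv R (X.obj ⊤)) (n : ℕ) : Shv R (X.obj (n : ℕ∞)) :=
  (pull R (toTop X n)).obj F

/-- The identification `(X_n^{n+1})^* 𝓕^{n+1} = 𝓕ⁿ`. -/
abbrev pulledIso (X : ℕ∞ ⥤ TopCat.{u}) (F : Shv R (X.obj ⊤)) (n : ℕ) :
    (pull R (step X n)).obj (pulled X F (n + 1)) ≅ pulled X F n :=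
  (pullComp R (step_toTop X n)).app F

/-- The copersistence module of type T: in degree `n` it is `H^k(X_n, 𝓕ⁿ)`, and its map from
degree `n + 1` to degree `n` is
`H^k(X_n^{n+1}) : H^k(X_{n+1}, 𝓕^{n+1}) ⟶ H^k(X_n, (X_n^{n+1})^* 𝓕^{n+1}) = H^k(X_n, 𝓕ⁿ)`. -/
def moduleT (X : ℕ∞ ⥤ TopCat.{u}) (F : Shv R (X.obj ⊤)) (k : ℕ) : ℕᵒᵖ ⥤ ModuleCat.{u} R :=
  Functor.ofOpSequence (X := fun n => (H R (X.obj (n : ℕ∞)) k).obj (pulled X F n)) fun n =>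
    inducedMap (step X n) (pulled X F (n + 1)) k ≫
      (H R (X.obj (n : ℕ∞)) k).map (pulledIso X F n).hom

/-- The diagram of sheaves on `X_∞` with `𝓖_n = (X_n^∞)_* 𝓕ⁿ`, whose map `𝓖_{n+1} ⟶ 𝓖_n` is
`(X_{n+1}^∞)_*` of the unit `𝓕^{n+1} ⟶ (X_n^{n+1})_* (X_n^{n+1})^* 𝓕^{n+1}`, followed by
the identifications
`(X_{n+1}^∞)_* (X_n^{n+1})_* (X_n^{n+1})^* 𝓕^{n+1} = (X_n^∞)_* (X_n^{n+1})^* 𝓕^{n+1} = 𝓖_n`. -/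
def diagramG (X : ℕ∞ ⥤ TopCat.{u}) (F : Shv R (X.obj ⊤)) : ℕᵒᵖ ⥤ Shv R (X.obj ⊤) :=
  Functor.ofOpSequence (X := fun n => (push R (toTop X n)).obj (pulled X F n)) fun n =>
    (push R (toTop X (n + 1))).map ((adj R (step X n)).unit.app (pulled X F (n + 1))) ≫
      (eqToHom (push_comp R (step_toTop X n))).app
        ((pull R (step X n)).obj (pulled X F (n + 1))) ≫
      (push R (toTop X n)).map (pulledIso X F n).hom

/-- The copersistence module of type A of a diagram of sheaves on a fixed space. -/
def moduleA {X : TopCat.{u}} (G : ℕᵒᵖ ⥤ Shv R X) (k : ℕ) : ℕᵒᵖ ⥤ ModuleCat.{u} R :=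
  G ⋙ H R X k

end SheafPersistence

end

namespace SheafPersistence

noncomputable section

section Acyclic

variable {B C D E : Type*} [Category* B] [Category* C] [Category* D] [Category* E]
  [Abelian B] [Abelian C] [Abelian D] [Abelian E]

/-- An exact functor preserving injective objects maps injective resolutions to injective
resolutions. -/
def mapInjectiveResolution (T : C ⥤ D) [T.Additive] [PreservesFiniteLimits T]
    [PreservesFiniteColimits T] [T.PreservesInjectiveObjects] {Z : C}
    (I : InjectiveResolution Z) : InjectiveResolution (T.obj Z) where
  cocomplex := (T.mapHomologicalComplex _).obj I.cocomplex
  injective n := T.injective_obj (I.cocomplex.X n)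
  hasHomology _ := inferInstance
  ι := (HomologicalComplex.singleMapHomologicalComplex _ _ _).inv.app _ ≫
    (T.mapHomologicalComplex _).map I.ι
  quasiIso := inferInstance

theorem mapInjectiveResolution_ι_f_zero (T : C ⥤ D) [T.Additive] [PreservesFiniteLimits T]
    [PreservesFiniteColimits T] [T.PreservesInjectiveObjects] {Z : C}
    (I : InjectiveResolution Z) :
    (mapInjectiveResolution T I).ι.f 0 = T.map (I.ι.f 0) := by
  simp [mapInjectiveResolution, HomologicalComplex.singleMapHomologicalComplex]
  exact Category.id_comp _

variable [HasInjectiveResolutions B] [HasInjectiveResolutions C] [HasInjectiveResolutions D]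
  (S : B ⥤ C) [S.Additive] [PreservesFiniteLimits S] [PreservesFiniteColimits S]
  [S.PreservesInjectiveObjects]
  (T : C ⥤ D) [T.Additive] [PreservesFiniteLimits T] [PreservesFiniteColimits T]
  [T.PreservesInjectiveObjects] (G : D ⥤ E) [G.Additive]

/-- The comparison of `R^k G (T Z)` with `R^k (T ⋙ G) Z` through an injective resolution of `Z`. -/
def rightDerivedCompIsoOf {Z : C} (I : InjectiveResolution Z) (k : ℕ) :
    (G.rightDerived k).obj (T.obj Z) ≅ ((T ⋙ G).rightDerived k).obj Z :=
  (mapInjectiveResolution T I).isoRightDerivedObj G k ≪≫ (I.isoRightDerivedObj (T ⋙ G) k).symm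

theorem rightDerivedCompIsoOf_naturality {Z W : C} (f : Z ⟶ W) (I : InjectiveResolution Z)
    (J : InjectiveResolution W) (k : ℕ) :
    (G.rightDerived k).map (T.map f) ≫ (rightDerivedCompIsoOf T G J k).hom =
      (rightDerivedCompIsoOf T G I k).hom ≫ ((T ⋙ G).rightDerived k).map f := by
  have hφ := InjectiveResolution.desc_commutes_zero f J I
  have hψ : (mapInjectiveResolution T I).ι.f 0 ≫
      ((T.mapHomologicalComplex _).map (InjectiveResolution.desc f J I)).f 0 =
        T.map f ≫ (mapInjectiveResolution T J).ι.f 0 := by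
    rw [mapInjectiveResolution_ι_f_zero, mapInjectiveResolution_ι_f_zero]
    exact (T.map_comp _ _).symm.trans ((congrArg T.map hφ).trans (T.map_comp _ _))
  exact (reassoc_of% InjectiveResolution.isoRightDerivedObj_hom_naturality (T.map f)
      (mapInjectiveResolution T I) (mapInjectiveResolution T J) _ hψ G k) _ |>.trans
    ((congrArg (_ ≫ ·) (InjectiveResolution.isoRightDerivedObj_inv_naturality f I J _ hφ
      (T ⋙ G) k).symm).trans (Category.assoc _ _ _).symm)

theorem rightDerivedCompIsoOf_eq {Z : C} (I J : InjectiveResolution Z) (k : ℕ) :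
    rightDerivedCompIsoOf T G I k = rightDerivedCompIsoOf T G J k := by
  ext1
  have := rightDerivedCompIsoOf_naturality T G (𝟙 Z) I J k
  rw [T.map_id, (G.rightDerived k).map_id, ((T ⋙ G).rightDerived k).map_id, Category.id_comp,
    Category.comp_id] at this
  exact this.symm

/-- If `T` is exact and preserves injective objects, then `R^k G ∘ T = R^k (G ∘ T)`. -/
def rightDerivedCompIso (k : ℕ) : T ⋙ G.rightDerived k ≅ (T ⋙ G).rightDerived k :=
  NatIso.ofComponents (fun Z => rightDerivedCompIsoOf T G (injectiveResolution Z) k)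
    fun f => rightDerivedCompIsoOf_naturality T G f _ _ k

theorem rightDerivedCompIso_app {Z : C} (I : InjectiveResolution Z) (k : ℕ) :
    (rightDerivedCompIso T G k).app Z = rightDerivedCompIsoOf T G I k :=
  rightDerivedCompIsoOf_eq T G _ _ k

theorem rightDerivedCompIso_comp (Z : B) (k : ℕ) :
    (rightDerivedCompIso T G k).hom.app (S.obj Z) ≫
        (rightDerivedCompIso S (T ⋙ G) k).hom.app Z =
      (rightDerivedCompIso (S ⋙ T) G k).hom.app Z := by
  let I := injectiveResolution Z
  change ((rightDerivedCompIso T G k).app _).hom ≫ ((rightDerivedCompIso S (T ⋙ G) k).app Z).hom =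
    ((rightDerivedCompIso (S ⋙ T) G k).app Z).hom
  rw [rightDerivedCompIso_app T G (mapInjectiveResolution S I), rightDerivedCompIso_app _ _ I,
    rightDerivedCompIso_app _ _ I]
  have h : (mapInjectiveResolution T (mapInjectiveResolution S I)).isoRightDerivedObj G k =
      (mapInjectiveResolution (S ⋙ T) I).isoRightDerivedObj G k := by
    ext1
    have := InjectiveResolution.isoRightDerivedObj_hom_naturality (𝟙 _)
      (mapInjectiveResolution T (mapInjectiveResolution S I))
      (mapInjectiveResolution (S ⋙ T) I) (𝟙 _) (by
        rw [mapInjectiveResolution_ι_f_zero, mapInjectiveResolution_ι_f_zero,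
          mapInjectiveResolution_ι_f_zero]
        exact (Category.comp_id _).trans (Category.id_comp _).symm) G k
    exact (Category.comp_id _).symm.trans <| (congrArg (_ ≫ ·)
        ((G.mapHomologicalComplex _ ⋙ HomologicalComplex.homologyFunctor E _ k).map_id _).symm).trans <|
      this.symm.trans <| (congrArg (· ≫ _) ((G.rightDerived k).map_id _)).trans <|
        Category.id_comp _
  have key {A : Type _} [Category A] {w x y z : A} (a : w ≅ x) (b : y ≅ x) (c : z ≅ x) :
      (a ≪≫ b.symm).hom ≫ (b ≪≫ c.symm).hom = (a ≪≫ c.symm).hom := by simp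
  refine (key ((mapInjectiveResolution T (mapInjectiveResolution S I)).isoRightDerivedObj G k)
    ((mapInjectiveResolution S I).isoRightDerivedObj (T ⋙ G) k)
    (I.isoRightDerivedObj (S ⋙ T ⋙ G) k)).trans ?_
  rw [h]
  rfl

end Acyclic

theorem map_comp_comp_of_squares {C D : Type*} [Category* C] [Category* D] (K : C ⥤ D)
    {A B A' B' : C} {a : A ⟶ B} {b : B ⟶ A'} {c : A' ⟶ B'} {P P' Q S : D} {p : K.obj A ⟶ P}
    {p' : K.obj B ⟶ P'} {q : K.obj A' ⟶ Q} {r : K.obj B' ⟶ S} {u : P ⟶ P'} {v : P' ⟶ Q}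
    {w : Q ⟶ S} (ha : K.map a ≫ p' = p ≫ u) (hb : K.map b ≫ q = p' ≫ v)
    (hc : K.map c ≫ r = q ≫ w) : K.map (a ≫ b ≫ c) ≫ r = p ≫ (u ≫ v) ≫ w := by
  simp only [Functor.map_comp, Category.assoc, hc, reassoc_of% hb, reassoc_of% ha]

section Leray

variable {R : Type u} [CommRing R] {X Y Z : TopCat.{u}}

theorem push_preservesInjectiveObjects (f : X ⟶ Y) : (push R f).PreservesInjectiveObjects where
  injective_obj {J} _ := Injective.injective_of_adjoint (adj R f) J

/-- `H^k(Y, f_* E) = H^k(X, E)`, naturally in `E`, when `f_*` is exact. -/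
def pushCohomologyIso (f : X ⟶ Y) (hf : exactFunctor _ _ (push R f)) (k : ℕ) :
    push R f ⋙ H R Y k ≅ H R X k :=
  haveI : PreservesFiniteLimits (push R f) := hf.1
  haveI : PreservesFiniteColimits (push R f) := hf.2
  haveI := push_preservesInjectiveObjects (R := R) f
  rightDerivedCompIso (push R f) (globalSections R Y) k

theorem pushCohomologyIso_comp (f : X ⟶ Y) (g : Y ⟶ Z) (h : X ⟶ Z) (w : f ≫ g = h)
    (hf : exactFunctor _ _ (push R f)) (hg : exactFunctor _ _ (push R g))
    (hh : exactFunctor _ _ (push R h)) (k : ℕ) (E : Shv R X) :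
    (H R Z k).map ((eqToHom (push_comp R w)).app E) ≫ (pushCohomologyIso h hh k).hom.app E =
      (pushCohomologyIso g hg k).hom.app ((push R f).obj E) ≫
        (pushCohomologyIso f hf k).hom.app E := by
  subst w
  have : PreservesFiniteLimits (push R f) := hf.1
  have : PreservesFiniteColimits (push R f) := hf.2
  have := push_preservesInjectiveObjects (R := R) f
  have : PreservesFiniteLimits (push R g) := hg.1
  have : PreservesFiniteColimits (push R g) := hg.2
  have := push_preservesInjectiveObjects (R := R) g
  exact ((congrArg (· ≫ _) ((H R Z k).map_id _)).trans (Category.id_comp _)).trans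
    (rightDerivedCompIso_comp (push R f) (push R g) (globalSections R Z) E k).symm

theorem inducedMap_eq (f : X ⟶ Y) (hf : exactFunctor _ _ (push R f)) (F : Shv R Y) (k : ℕ) :
    inducedMap f F k =
      (H R Y k).map ((adj R f).unit.app F) ≫
        (pushCohomologyIso f hf k).hom.app ((pull R f).obj F) := by
  have : PreservesFiniteLimits (push R f) := hf.1
  have : PreservesFiniteColimits (push R f) := hf.2
  have := push_preservesInjectiveObjects (R := R) f
  let I := injectiveResolution F
  let J := injectiveResolution ((pull R f).obj F)
  let φ : I.cocomplex ⟶ (mapInjectiveResolution (push R f) J).cocomplex :=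
    (NatTrans.mapHomologicalComplex (adj R f).unit _).app I.cocomplex ≫
      ((push R f).mapHomologicalComplex _).map (pullLift f I J)
  have hφ : I.ι.f 0 ≫ φ.f 0 =
      (adj R f).unit.app F ≫ (mapInjectiveResolution (push R f) J).ι.f 0 := by
    rw [mapInjectiveResolution_ι_f_zero]
    refine Eq.trans ?_ (congrArg (fun a => (adj R f).unit.app F ≫ (push R f).map a)
      (exists_pull_lift f I J).choose_spec)
    have hn := (adj R f).unit.naturality (I.ι.f 0 : F ⟶ I.cocomplex.X 0)
    refine ((reassoc_of% hn) ((push R f).map ((pullLift f I J).f 0))).trans ?_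
    exact congrArg (_ ≫ ·) ((push R f).map_comp _ _).symm
  have := InjectiveResolution.isoRightDerivedObj_hom_naturality _ I
    (mapInjectiveResolution (push R f) J) φ hφ (globalSections R Y) k
  refine Eq.symm (((reassoc_of% this) (J.isoRightDerivedObj (globalSections R X) k).inv).trans ?_)
  refine congrArg (fun a => _ ≫ HomologicalComplex.homologyMap a k ≫ _) ?_
  ext n : 1
  exact (globalSections R Y).map_comp _ _

end Leray

end
end SheafPersistence

open SheafPersistence

theorem theorem112 {R : Type u} [CommRing R] (X : ℕ∞ ⥤ TopCat.{u})
    (hX : ∀ (i j : ℕ∞) (h : i ≤ j),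
      exactFunctor _ _ (SheafPersistence.push R (SheafPersistence.transition X h)))
    (F : SheafPersistence.Shv R (X.obj ⊤)) (k : ℕ) :
    Nonempty (SheafPersistence.moduleT X F k ≅
      SheafPersistence.moduleA (SheafPersistence.diagramG X F) k) := by
  let e (n : ℕ) : (moduleA (diagramG X F) k).obj ⟨n⟩ ≅ (moduleT X F k).obj ⟨n⟩ :=
    (pushCohomologyIso (toTop X n) (hX _ _ _) k).app (pulled X F n)
  let α : moduleA (diagramG X F) k ⟶ moduleT X F k :=
    NatTrans.ofOpSequence (fun n => (e n).hom) fun n => by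
      let E := (pull R (step X n)).obj (pulled X F (n + 1))
      have hs := pushCohomologyIso_comp (step X n) (toTop X (n + 1)) _ (step_toTop X n)
        (hX _ _ _) (hX _ _ _) (hX _ _ _) k E
      have hu := (pushCohomologyIso (toTop X (n + 1)) (hX _ _ _) k).hom.naturality
        ((adj R (step X n)).unit.app (pulled X F (n + 1)))
      have hp := (pushCohomologyIso (toTop X n) (hX _ _ _) k).hom.naturality
        (pulledIso X F n).hom
      have hi := inducedMap_eq (step X n) (hX _ _ _) (pulled X F (n + 1)) k
      simp only [moduleA, moduleT, diagramG, Functor.comp_map,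
        Functor.ofOpSequence_map_homOfLE_succ, hi]
      exact map_comp_comp_of_squares _ hu hs hp
  have (a : ℕᵒᵖ) : IsIso (α.app a) := inferInstanceAs (IsIso (e a.unop).hom)
  have := NatIso.isIso_of_isIso_app α
  exact ⟨(asIso α).symm⟩
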